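/- For functions $\omega,d:(0,\infty)\times\mathbb R^2\to\mathbb R$ consider the extended Navier–Stokes system $$\partial_t\omega+\nabla\cdot(u\,\omega)=\Delta\omega,\qquad \partial_t d=\Delta d,\qquad u=K_{BS}*\omega+\nabla^{-1}d,$$ where $K_{BS}(x)=\frac1{2\pi}\frac{x^\perp}{|x|^2}$, $x^\perp=(-x_2,x_1)$, and $\nabla^{-1}f=\frac1{2\pi}\frac{x}{|x|^2}*f$. Solutions are classical for $t>0$ ($C^2$ in $x$, differentiable in $t$), with the convolutions defining $u$ absolutely convergent. A solution is radially symmetric if, for each $t>0$, $\omega(\cdot,t)$ and $d(\cdot,t)$ depend only on $|x|$, and self-similar if $\lambda^2\omega(\lambda x,\lambda^2t)=\omega(x,t)$ and $\lambda^2d(\lambda x,\lambda^2t)=d(x,t)$ for all $\lambda,t>0$, $x\in\mathbb R^2$. Let $G(x)=\frac1{4\pi}e^{-|x|^2/4}$. (1) For every $\beta\in\mathbb R$ there is exactly one continuous radial function $W_s=W_s(\beta)$ on $\mathbb R^2$, differentiable and nonvanishing away from the origin, such that $$\frac{\partial_rW_s}{W_s}=-\frac r2+\frac{\beta}{2\pi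 r}\bigl(1-e^{-r^2/4}\bigr)\quad(r>0),\qquad \int_{\mathbb R^2}W_s\,dx=1.$$ (2) Put $\tilde\omega_\beta(x,t)=\frac1tW_s\bigl(\frac{x}{\sqrt t}\bigr)$ and $\tilde d_\beta(x,t)=\frac{\beta}{t}G\bigl(\frac{x}{\sqrt t}\bigr)$. For all $\alpha,\beta\in\mathbb R$, the pair $(\alpha\tilde\omega_\beta,\tilde d_\beta)$ is a radially symmetric self-similar solution of the system. (3) Conversely, every radially symmetric self-similar solution $(\omega,d)$ of the system is of this form: there are $\alpha,\beta\in\mathbb R$ with $(\omega,d)=(\alpha\tilde\omega_\beta,\tilde d_\beta)$ for all $t>0$. Moreover $\omega(\cdot,t)$ and $d(\cdot,t)$ are then integrable, and $\alpha=\int_{\mathbb R^2}\omega(x,t)\,dx$, $\beta=\int_{\mathbb R^2}d(x,t)\,dx$ for every $t>0$. -/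

import Mathlib

open MeasureTheory

noncomputable section

namespace ExtendedNS

/-- The Euclidean plane. -/
abbrev Plane : Type := EuclideanSpace ℝ (Fin 2)

/-- Rotation by a right angle, `x^⊥ = (-x₂, x₁)`. -/
def perp (x : Plane) : Plane := !₂[-(x 1), x 0]

/-- The Biot–Savart kernel `x^⊥ / (2π|x|²)`. -/
def kernelBS (x : Plane) : Plane := (2 * Real.pi * ‖x‖ ^ 2)⁻¹ • perp x

/-- The kernel `x / (2π|x|²)` of the operator `∇⁻¹`. -/
def kernelInvGrad (x : Plane) : Plane := (2 * Real.pi * ‖x‖ ^ 2)⁻¹ • x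

/-- `K_BS * f`. -/
def biotSavart (f : Plane → ℝ) : Plane → Plane :=
  convolution f kernelBS (ContinuousLinearMap.lsmul ℝ ℝ) volume

/-- `∇⁻¹ f = x / (2π|x|²) * f`. -/
def invGrad (f : Plane → ℝ) : Plane → Plane :=
  convolution f kernelInvGrad (ContinuousLinearMap.lsmul ℝ ℝ) volume

/-- The velocity field with vorticity `w` and divergence `q`. -/
def velocity (w q : Plane → ℝ) : Plane → Plane := fun x => biotSavart w x + invGrad q x

/-- The divergence of a vector field on the plane. -/
def divergence (v : Plane → Plane) (x : Plane) : ℝ :=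
  ∑ i : Fin 2, (fderiv ℝ v x (EuclideanSpace.single i 1)) i

/-- `(ω, d)` is a classical solution, for positive times, of
`∂ₜ ω + ∇ · (u ω) = Δ ω`, `∂ₜ d = Δ d`, `u = K_BS * ω + ∇⁻¹ d`.
The integrals defining `u` are required to converge absolutely; differentiability of `u` in space
(needed for `∇ · (u ω)`) follows from the other conditions and is recorded for convenience. -/
structure IsSolution (ω d : ℝ → Plane → ℝ) : Prop where
  contDiff_vorticity : ∀ t, 0 < t → ContDiff ℝ 2 (ω t)
  contDiff_div : ∀ t, 0 < t → ContDiff ℝ 2 (d t)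
  differentiableAt_vorticity : ∀ t, 0 < t → ∀ x, DifferentiableAt ℝ (fun s => ω s x) t
  differentiableAt_div : ∀ t, 0 < t → ∀ x, DifferentiableAt ℝ (fun s => d s x) t
  convolutionExists_vorticity : ∀ t, 0 < t →
    ConvolutionExists (ω t) kernelBS (ContinuousLinearMap.lsmul ℝ ℝ) volume
  convolutionExists_div : ∀ t, 0 < t →
    ConvolutionExists (d t) kernelInvGrad (ContinuousLinearMap.lsmul ℝ ℝ) volume
  differentiable_velocity : ∀ t, 0 < t → Differentiable ℝ (velocity (ω t) (d t))
  vorticity_eq : ∀ t, 0 < t → ∀ x,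
    deriv (fun s => ω s x) t + divergence (fun y => ω t y • velocity (ω t) (d t) y) x
      = Laplacian.laplacian (ω t) x
  div_eq : ∀ t, 0 < t → ∀ x, deriv (fun s => d s x) t = Laplacian.laplacian (d t) x

/-- A function on the plane is radial if it depends only on `|x|`. -/
def IsRadial (f : Plane → ℝ) : Prop := ∀ x y : Plane, ‖x‖ = ‖y‖ → f x = f y

/-- Invariance under the scaling `f(x,t) ↦ l² f(l x, l² t)`, `l > 0`, of the system. -/
def IsSelfSimilar (f : ℝ → Plane → ℝ) : Prop :=
  ∀ l : ℝ, 0 < l → ∀ t : ℝ, 0 < t → ∀ x : Plane, l ^ 2 * f (l ^ 2 * t) (l • x) = f t x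

/-- `(ω, d)` is a radially symmetric self-similar solution of the system. -/
structure IsRadialSelfSimilarSolution (ω d : ℝ → Plane → ℝ) : Prop where
  solution : IsSolution ω d
  radial_vorticity : ∀ t, 0 < t → IsRadial (ω t)
  radial_div : ∀ t, 0 < t → IsRadial (d t)
  selfSimilar_vorticity : IsSelfSimilar ω
  selfSimilar_div : IsSelfSimilar d

/-- The Gaussian `G(x) = exp(-|x|²/4) / (4π)`. -/
def gaussian (x : Plane) : ℝ := (4 * Real.pi)⁻¹ * Real.exp (-(‖x‖ ^ 2) / 4)

/-- The rescaling `t⁻¹ F(x/√t)`. -/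
def rescale (F : Plane → ℝ) (t : ℝ) (x : Plane) : ℝ := t⁻¹ * F ((Real.sqrt t)⁻¹ • x)

/-- The radial derivative `∂_r W`, away from the origin. -/
def radialDeriv (W : Plane → ℝ) (x : Plane) : ℝ := fderiv ℝ W x (‖x‖⁻¹ • x)

/-- `W` is a radial solution with total mass one of
`∂_r W / W = -r/2 + β/(2πr) (1 - exp(-r²/4))`, `r > 0`. -/
structure IsVortexProfile (β : ℝ) (W : Plane → ℝ) : Prop where
  continuous : Continuous W
  radial : IsRadial W
  differentiableAt : ∀ x, x ≠ 0 → DifferentiableAt ℝ W x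
  ne_zero : ∀ x, x ≠ 0 → W x ≠ 0
  ode : ∀ x, x ≠ 0 → radialDeriv W x / W x =
    -‖x‖ / 2 + β / (2 * Real.pi * ‖x‖) * (1 - Real.exp (-(‖x‖ ^ 2) / 4))
  integrable : Integrable W
  mass : ∫ x, W x = 1

end ExtendedNS

end

/-!
In the variables `x / √t` a self-similar solution is stationary, and both equations then say that a
vector field on the plane is divergence free. For radial profiles the Biot–Savart velocity is
tangential to circles and drops out, while the other part of the velocity is determined by the
amount of divergence enclosed by a circle: averaged over a circle, the Cauchy kernel `1 / (w - z)`
is `1 / w` if `w` lies outside the circle and `0` if it lies inside.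

The flux of the divergence-free field through a circle does not depend on the circle, and it tends
to zero at the origin. A vanishing flux is a first-order linear equation in `s = ‖x‖ ^ 2`, whose
solutions are the multiples of one positive function with Gaussian decay. Applied first to the
divergence, which diffuses independently of the vorticity, this gives a multiple of the Gaussian;
applied then to the vorticity, whose drift is now known, it gives a multiple of the vortex profile.
-/

open MeasureTheory Set Filter Topology

namespace ExtendedNS

theorem integrableOn_comp_polarCoord_symm {E : Type*} [NormedAddCommGroup E] [NormedSpace ℝ E]
    {f : ℂ → E} (hf : Integrable f) :
    IntegrableOn (fun p : ℝ × ℝ => p.1 • f (Complex.polarCoord.symm p)) polarCoord.target := by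
  have hprod : Integrable (f ∘ Complex.measurableEquivRealProd.symm) :=
    (Complex.volume_preserving_equiv_real_prod.symm.integrable_comp_emb
      Complex.measurableEquivRealProd.symm.measurableEmbedding).2 hf
  have hpolar := (integrableOn_image_iff_integrableOn_abs_det_fderiv_smul volume
    polarCoord.open_target.measurableSet
    (fun p _ => (hasFDerivAt_polarCoord_symm p).hasFDerivWithinAt) polarCoord.symm.injOn
    (f ∘ Complex.measurableEquivRealProd.symm)).1 hprod.integrableOn
  refine hpolar.congr_fun (fun p hp => ?_) polarCoord.open_target.measurableSet
  have hp_pos : 0 < p.1 := hp.1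
  simp only [det_fderivPolarCoordSymm, abs_of_pos hp_pos, Function.comp_apply,
    Complex.measurableEquivRealProd_symm_polarCoord_symm_apply]

theorem setIntegral_polarCoord_symm_eq_circleAverage {E : Type*} [NormedAddCommGroup E]
    [NormedSpace ℝ E] (f : ℂ → E) (r : ℝ) :
    ∫ θ in Ioo (-Real.pi) Real.pi, f (Complex.polarCoord.symm (r, θ))
      = (2 * Real.pi) • Real.circleAverage f 0 r := by
  have hcircle (θ : ℝ) : Complex.polarCoord.symm (r, θ) = circleMap 0 r θ := by
    simp [Complex.polarCoord_symm_apply, circleMap, Complex.exp_mul_I]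
  have hperiodic : Function.Periodic (fun θ => f (circleMap 0 r θ)) (2 * Real.pi) :=
    (periodic_circleMap 0 r).comp f
  have hshift := hperiodic.intervalIntegral_add_eq (-Real.pi) 0
  rw [show -Real.pi + 2 * Real.pi = Real.pi by ring, zero_add] at hshift
  simp_rw [hcircle]
  rw [← integral_Ioc_eq_integral_Ioo,
    ← intervalIntegral.integral_of_le (by linarith [Real.pi_pos]), hshift, Real.circleAverage,
    smul_smul, mul_inv_cancel₀ (by positivity), one_smul]

theorem integral_eq_setIntegral_circleAverage {E : Type*} [NormedAddCommGroup E]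
    [NormedSpace ℝ E] {f : ℂ → E} (hf : Integrable f) :
    ∫ z, f z = (2 * Real.pi) • ∫ r in Ioi (0 : ℝ), r • Real.circleAverage f 0 r := by
  have hint := integrableOn_comp_polarCoord_symm hf
  have htarget : polarCoord.target = Ioi (0 : ℝ) ×ˢ Ioo (-Real.pi) Real.pi := rfl
  rw [← Complex.integral_comp_polarCoord_symm]
  rw [htarget, Measure.volume_eq_prod] at hint ⊢
  rw [setIntegral_prod _ hint, ← integral_smul]
  refine integral_congr_ae (Eventually.of_forall fun r => ?_)
  simp only [integral_smul, setIntegral_polarCoord_symm_eq_circleAverage]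
  rw [smul_comm]

theorem circleAverage_inv_sub_of_lt {w : ℂ} {r : ℝ} (h : |r| < ‖w‖) :
    Real.circleAverage (fun z => (w - z)⁻¹) 0 r = w⁻¹ := by
  have hdiff : DiffContOnCl ℂ (fun z => (w - z)⁻¹) (Metric.ball 0 |r|) := by
    refine DifferentiableOn.diffContOnCl fun z hz => ?_
    have hz_le : ‖z‖ ≤ |r| :=
      mem_closedBall_zero_iff.1 (Metric.closure_ball_subset_closedBall hz)
    have hne : w - z ≠ 0 := sub_ne_zero.2 (by rintro rfl; exact absurd hz_le (not_le.2 h))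
    exact (DifferentiableAt.inv (by fun_prop) hne).differentiableWithinAt
  rw [hdiff.circleAverage, sub_zero]

theorem circleAverage_inv_sub_of_gt {w : ℂ} {r : ℝ} (h : ‖w‖ < r) :
    Real.circleAverage (fun z => (w - z)⁻¹) 0 r = 0 := by
  have hdiff : DiffContOnCl ℂ (fun z => z * (w * z - r)⁻¹) (Metric.ball 0 |1|) := by
    refine DifferentiableOn.diffContOnCl fun z hz => ?_
    have hz_le : ‖z‖ ≤ 1 := by
      simpa using Metric.closure_ball_subset_closedBall hz
    have hne : w * z - r ≠ 0 := by
      refine sub_ne_zero.2 fun heq => ?_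
      have hnorm : ‖w‖ * ‖z‖ = |r| := by simpa using congrArg norm heq
      have := mul_le_of_le_one_right (norm_nonneg w) hz_le
      linarith [le_abs_self r]
    have hden : DifferentiableAt ℂ (fun z => w * z - r) z := by fun_prop
    exact (differentiableAt_id.mul (hden.inv hne)).differentiableWithinAt
  calc Real.circleAverage (fun z => (w - z)⁻¹) 0 r
      = Real.circleAverage (fun z => (w - r * z)⁻¹) 0 1 := by
        rw [Real.circleAverage_eq_circleAverage_zero_one]
        simp only [add_zero]
    _ = Real.circleAverage (fun z => (w - r * z⁻¹)⁻¹) 0 1 :=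
        (Real.circleAverage_zero_one_congr_inv (f := fun z => (w - r * z)⁻¹)).symm
    _ = Real.circleAverage (fun z => z * (w * z - r)⁻¹) 0 1 := by
        refine Real.circleAverage_congr_sphere fun z hz => ?_
        have hz_ne : z ≠ 0 := by
          rintro rfl
          simp at hz
        rw [show w * z - r = (w - r * z⁻¹) * z by field_simp, mul_inv, mul_left_comm,
          mul_inv_cancel₀ hz_ne, mul_one]
    _ = 0 := by rw [hdiff.circleAverage, zero_mul]

theorem integral_radial_mul_inv_sub (F : ℝ → ℝ) (w : ℂ)
    (hF : Integrable (fun z : ℂ => F ‖z‖ • (w - z)⁻¹)) :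
    ∫ z : ℂ, F ‖z‖ • (w - z)⁻¹ = (2 * Real.pi * ∫ r in (0 : ℝ)..‖w‖, r * F r) • w⁻¹ := by
  have haverage : ∀ᵐ r ∂volume.restrict (Ioi (0 : ℝ)),
      r • Real.circleAverage (fun z => F ‖z‖ • (w - z)⁻¹) 0 r
        = (Iio ‖w‖).indicator (fun r => (r * F r) • w⁻¹) r := by
    filter_upwards [ae_restrict_of_ae (Measure.ae_ne volume ‖w‖),
      ae_restrict_mem measurableSet_Ioi] with r hr_ne (hr_pos : 0 < r)
    have hpull : Real.circleAverage (fun z => F ‖z‖ • (w - z)⁻¹) 0 r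
        = F r • Real.circleAverage (fun z => (w - z)⁻¹) 0 r := by
      rw [← Real.circleAverage_fun_smul]
      refine Real.circleAverage_congr_sphere fun z hz => ?_
      rw [mem_sphere_zero_iff_norm, abs_of_pos hr_pos] at hz
      simp only [hz]
    rw [hpull]
    rcases lt_or_gt_of_ne hr_ne with h | h
    · rw [circleAverage_inv_sub_of_lt (by rwa [abs_of_pos hr_pos]),
        indicator_of_mem (mem_Iio.2 h), smul_smul]
    · rw [circleAverage_inv_sub_of_gt h, indicator_of_notMem (notMem_Iio.2 h.le), smul_zero,
        smul_zero]
  rw [integral_eq_setIntegral_circleAverage hF, integral_congr_ae haverage,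
    setIntegral_indicator measurableSet_Iio, Ioi_inter_Iio, integral_smul_const, smul_smul,
    ← integral_Ioc_eq_integral_Ioo, ← intervalIntegral.integral_of_le (norm_nonneg w)]

/-- The average of `F` over the segment from `0` to `ρ`, that is `ρ⁻¹ * ∫ s in 0..ρ, F s` away from
`ρ = 0`. It records how much of a radial density lies inside a circle, and in this form it is
visibly as smooth at the origin as `F`. -/
noncomputable def segmentAverage (F : ℝ → ℝ) (ρ : ℝ) : ℝ := ∫ s in (0 : ℝ)..1, F (ρ * s)

theorem segmentAverage_zero_left : segmentAverage 0 = 0 := by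
  ext ρ
  simp [segmentAverage]

theorem mul_segmentAverage (F : ℝ → ℝ) (ρ : ℝ) :
    ρ * segmentAverage F ρ = ∫ s in (0 : ℝ)..ρ, F s := by
  simp [segmentAverage]

theorem continuous_segmentAverage {F : ℝ → ℝ} (hF : Continuous F) :
    Continuous (segmentAverage F) :=
  intervalIntegral.continuous_parametric_intervalIntegral_of_continuous' (by fun_prop) 0 1

theorem differentiableAt_segmentAverage_of_ne_zero {F : ℝ → ℝ} (hF : Continuous F) {ρ : ℝ}
    (hρ : ρ ≠ 0) : DifferentiableAt ℝ (segmentAverage F) ρ := by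
  have hquot : DifferentiableAt ℝ (fun s => s⁻¹ * ∫ u in (0 : ℝ)..s, F u) ρ :=
    (differentiableAt_inv hρ).mul (hF.integral_hasStrictDerivAt 0 ρ).hasDerivAt.differentiableAt
  refine hquot.congr_of_eventuallyEq ?_
  filter_upwards [isOpen_ne.mem_nhds hρ] with s hs
  rw [← mul_segmentAverage, inv_mul_cancel_left₀ hs]

theorem hasDerivAt_segmentAverage {F : ℝ → ℝ} (hF : ContDiff ℝ 1 F) (ρ : ℝ) :
    HasDerivAt (segmentAverage F) (∫ s in (0 : ℝ)..1, deriv F (ρ * s) * s) ρ := by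
  have hF_cont := hF.continuous
  have hF'_cont : Continuous (deriv F) := hF.continuous_deriv le_rfl
  obtain ⟨C, hC⟩ := (isCompact_closedBall (0 : ℝ) (|ρ| + 1)).exists_bound_of_continuousOn
    hF'_cont.continuousOn
  have hbound : ∀ s ∈ Ioc (0 : ℝ) 1, ∀ x ∈ Metric.ball ρ 1, ‖deriv F (x * s) * s‖ ≤ C := by
    intro s hs x hx
    have hx_le : |x| ≤ |ρ| + 1 := by
      have := abs_sub_abs_le_abs_sub x ρ
      have : |x - ρ| < 1 := hx
      linarith
    have hs_le : |s| ≤ 1 := (abs_of_pos hs.1).trans_le hs.2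
    have hderiv : ‖deriv F (x * s)‖ ≤ C := by
      refine hC _ (mem_closedBall_zero_iff.2 ?_)
      rw [Real.norm_eq_abs, abs_mul]
      exact (mul_le_of_le_one_right (abs_nonneg x) hs_le).trans hx_le
    rw [norm_mul]
    exact (mul_le_of_le_one_right (norm_nonneg _) hs_le).trans hderiv
  refine (intervalIntegral.hasDerivAt_integral_of_dominated_loc_of_deriv_le (μ := volume)
    (F := fun x s => F (x * s)) (F' := fun x s => deriv F (x * s) * s) (bound := fun _ => C)
    (Metric.ball_mem_nhds ρ one_pos)
    (Eventually.of_forall fun x => (by fun_prop : Continuous _).aestronglyMeasurable)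
    ((by fun_prop : Continuous _).intervalIntegrable _ _)
    (by fun_prop : Continuous _).aestronglyMeasurable
    (Eventually.of_forall fun s hs => hbound s (uIoc_of_le (zero_le_one' ℝ) ▸ hs))
    intervalIntegrable_const (Eventually.of_forall fun s _ x _ => ?_)).2
  exact (hF.differentiable one_ne_zero (x * s)).hasDerivAt.comp x
    (by simpa using (hasDerivAt_id x).mul_const s)

theorem contDiff_segmentAverage {F : ℝ → ℝ} (hF : ContDiff ℝ 1 F) :
    ContDiff ℝ 1 (segmentAverage F) := by
  have : Continuous (deriv F) := hF.continuous_deriv le_rfl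
  refine contDiff_one_iff_deriv.2
    ⟨fun ρ => (hasDerivAt_segmentAverage hF ρ).differentiableAt, ?_⟩
  rw [funext fun ρ => (hasDerivAt_segmentAverage hF ρ).deriv]
  exact intervalIntegral.continuous_parametric_intervalIntegral_of_continuous' (by fun_prop) 0 1

theorem segmentAverage_add_mul_deriv {F : ℝ → ℝ} (hF : Continuous F) {ρ : ℝ}
    (h : DifferentiableAt ℝ (segmentAverage F) ρ) :
    segmentAverage F ρ + ρ * deriv (segmentAverage F) ρ = F ρ := by
  have hprimitive : HasDerivAt (fun s => s * segmentAverage F s) (F ρ) ρ := by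
    simp_rw [mul_segmentAverage]
    exact (hF.integral_hasStrictDerivAt 0 ρ).hasDerivAt
  simpa using ((hasDerivAt_id ρ).mul h.hasDerivAt).unique hprimitive

theorem integral_mul_comp_sq {F : ℝ → ℝ} (hF : Continuous F) (R : ℝ) :
    ∫ r in (0 : ℝ)..R, r * F (r ^ 2) = (∫ s in (0 : ℝ)..R ^ 2, F s) / 2 := by
  have hsubst := intervalIntegral.integral_comp_mul_deriv (a := 0) (b := R) (f := fun r => r ^ 2)
    (f' := fun r => 2 * r) (g := F) (fun r _ => by simpa using hasDerivAt_pow 2 r)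
    (by fun_prop) hF
  rw [zero_pow two_ne_zero] at hsubst
  rw [← hsubst, ← intervalIntegral.integral_div]
  refine intervalIntegral.integral_congr fun r _ => ?_
  simp only [Function.comp_apply]
  ring

/-- The identification of `ℂ` with the plane, which turns `kernelInvGrad` into the conjugate of the
Cauchy kernel. -/
noncomputable def complexIsometry : ℂ ≃ₗᵢ[ℝ] Plane := Complex.orthonormalBasisOneI.repr

/-- The identification of `ℂ` with the plane preceded by complex conjugation. -/
noncomputable def conjIsometry : ℂ ≃ₗᵢ[ℝ] Plane := Complex.conjLIE.trans complexIsometry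

theorem conjIsometry_inv (z : ℂ) : conjIsometry z⁻¹ = (‖z‖ ^ 2)⁻¹ • complexIsometry z := by
  have hconj : (starRingEnd ℂ) z⁻¹ = (‖z‖ ^ 2)⁻¹ • z := by
    rw [Complex.inv_def, map_mul, Complex.conj_conj, Complex.conj_ofReal,
      Complex.normSq_eq_norm_sq, mul_comm, Complex.real_smul]
  rw [← map_smul, ← hconj]
  rfl

theorem kernelInvGrad_complexIsometry (z : ℂ) :
    kernelInvGrad (complexIsometry z) = (2 * Real.pi)⁻¹ • conjIsometry z⁻¹ := by
  rw [conjIsometry_inv, kernelInvGrad, LinearIsometryEquiv.norm_map, smul_smul, mul_inv]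

theorem smul_kernelInvGrad_complexIsometry_sub (a : ℝ) (w z : ℂ) :
    a • kernelInvGrad (complexIsometry w - complexIsometry z)
      = (2 * Real.pi)⁻¹ • conjIsometry (a • (w - z)⁻¹) := by
  rw [← map_sub, kernelInvGrad_complexIsometry, map_smul, smul_comm]

theorem convolutionExistsAt_kernelInvGrad_iff {f : Plane → ℝ} {w : ℂ} :
    ConvolutionExistsAt f kernelInvGrad (complexIsometry w)
        (ContinuousLinearMap.lsmul ℝ ℝ) volume ↔
      Integrable (fun z : ℂ => f (complexIsometry z) • (w - z)⁻¹) := by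
  rw [ConvolutionExistsAt, ← complexIsometry.measurePreserving.integrable_comp_emb
    complexIsometry.toHomeomorph.measurableEmbedding]
  simp only [Function.comp_def, ContinuousLinearMap.lsmul_apply,
    smul_kernelInvGrad_complexIsometry_sub]
  rw [integrable_fun_smul_iff (by positivity)]
  exact conjIsometry.toContinuousLinearEquiv.integrable_comp_iff

theorem invGrad_complexIsometry (f : Plane → ℝ) (w : ℂ) :
    invGrad f (complexIsometry w)
      = (2 * Real.pi)⁻¹ • conjIsometry (∫ z : ℂ, f (complexIsometry z) • (w - z)⁻¹) := by
  rw [invGrad, convolution, ← complexIsometry.measurePreserving.integral_comp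
    complexIsometry.toHomeomorph.measurableEmbedding]
  simp only [ContinuousLinearMap.lsmul_apply, smul_kernelInvGrad_complexIsometry_sub]
  rw [integral_smul]
  congr 1
  exact conjIsometry.toContinuousLinearEquiv.integral_comp_comm _

theorem invGrad_comp_norm {F : ℝ → ℝ} {x : Plane}
    (h : ConvolutionExistsAt (fun y => F ‖y‖) kernelInvGrad x
      (ContinuousLinearMap.lsmul ℝ ℝ) volume) :
    invGrad (fun y => F ‖y‖) x = ((‖x‖ ^ 2)⁻¹ * ∫ r in (0 : ℝ)..‖x‖, r * F r) • x := by
  obtain ⟨w, rfl⟩ := complexIsometry.surjective x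
  rw [convolutionExistsAt_kernelInvGrad_iff] at h
  simp only [LinearIsometryEquiv.norm_map] at h
  rw [invGrad_complexIsometry]
  simp only [LinearIsometryEquiv.norm_map]
  rw [integral_radial_mul_inv_sub F w h, map_smul, conjIsometry_inv, smul_smul, smul_smul]
  congr 1
  field_simp

theorem invGrad_comp_norm_sq {F : ℝ → ℝ} (hF : Continuous F) {x : Plane}
    (h : ConvolutionExistsAt (fun y => F (‖y‖ ^ 2)) kernelInvGrad x
      (ContinuousLinearMap.lsmul ℝ ℝ) volume) :
    invGrad (fun y => F (‖y‖ ^ 2)) x = (segmentAverage F (‖x‖ ^ 2) / 2) • x := by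
  rw [invGrad_comp_norm (F := fun r => F (r ^ 2)) h, integral_mul_comp_sq hF,
    ← mul_segmentAverage]
  rcases eq_or_ne x 0 with rfl | hx
  · simp only [smul_zero]
  · have : ‖x‖ ≠ 0 := norm_ne_zero_iff.2 hx
    congr 1
    field_simp

/-- Rotation by a right angle as a linear isometry. -/
noncomputable def perpIsometry : Plane ≃ₗᵢ[ℝ] Plane where
  toFun := perp
  invFun x := -perp x
  map_add' x y := by ext i; fin_cases i <;> simp [perp]; ring
  map_smul' c x := by ext i; fin_cases i <;> simp [perp]
  left_inv x := by ext i; fin_cases i <;> simp [perp]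
  right_inv x := by ext i; fin_cases i <;> simp [perp]
  norm_map' x := by simp [EuclideanSpace.norm_eq, perp, add_comm]

theorem perp_smul (c : ℝ) (x : Plane) : perp (c • x) = c • perp x := map_smul perpIsometry c x

theorem kernelBS_eq_perp (x : Plane) : kernelBS x = perp (kernelInvGrad x) := by
  rw [kernelInvGrad, perp_smul, kernelBS]

theorem convolutionExistsAt_kernelBS_iff {f : Plane → ℝ} {x : Plane} :
    ConvolutionExistsAt f kernelBS x (ContinuousLinearMap.lsmul ℝ ℝ) volume ↔
      ConvolutionExistsAt f kernelInvGrad x (ContinuousLinearMap.lsmul ℝ ℝ) volume := by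
  simp only [ConvolutionExistsAt, ContinuousLinearMap.lsmul_apply, kernelBS_eq_perp, ← perp_smul]
  exact perpIsometry.toContinuousLinearEquiv.integrable_comp_iff

theorem biotSavart_eq_perp_invGrad (f : Plane → ℝ) (x : Plane) :
    biotSavart f x = perp (invGrad f x) := by
  simp only [biotSavart, invGrad, convolution, ContinuousLinearMap.lsmul_apply, kernelBS_eq_perp,
    ← perp_smul]
  exact perpIsometry.toContinuousLinearEquiv.integral_comp_comm _

theorem velocity_comp_norm_sq {F D : ℝ → ℝ} (hF : Continuous F) (hD : Continuous D) {x : Plane}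
    (hF_conv : ConvolutionExistsAt (fun y => F (‖y‖ ^ 2)) kernelBS x
      (ContinuousLinearMap.lsmul ℝ ℝ) volume)
    (hD_conv : ConvolutionExistsAt (fun y => D (‖y‖ ^ 2)) kernelInvGrad x
      (ContinuousLinearMap.lsmul ℝ ℝ) volume) :
    velocity (fun y => F (‖y‖ ^ 2)) (fun y => D (‖y‖ ^ 2)) x
      = (segmentAverage D (‖x‖ ^ 2) / 2) • x + (segmentAverage F (‖x‖ ^ 2) / 2) • perp x := by
  rw [velocity, biotSavart_eq_perp_invGrad, invGrad_comp_norm_sq hD hD_conv,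
    invGrad_comp_norm_sq hF (convolutionExistsAt_kernelBS_iff.1 hF_conv), perp_smul, add_comm]

theorem norm_kernelInvGrad (x : Plane) : ‖kernelInvGrad x‖ = (2 * Real.pi)⁻¹ * ‖x‖⁻¹ := by
  rcases eq_or_ne x 0 with rfl | hx
  · simp [kernelInvGrad]
  · have : ‖x‖ ≠ 0 := norm_ne_zero_iff.2 hx
    rw [kernelInvGrad, norm_smul, norm_inv, Real.norm_of_nonneg (by positivity)]
    field_simp

theorem measurable_kernelInvGrad : Measurable kernelInvGrad := by
  unfold kernelInvGrad
  fun_prop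

theorem locallyIntegrable_kernelInvGrad : LocallyIntegrable kernelInvGrad := by
  refine locallyIntegrable_of_norm_le_rpow (C := (2 * Real.pi)⁻¹) (α := 1) (by simp) (by simp)
    (Eventually.of_forall fun x => ?_) measurable_kernelInvGrad.aestronglyMeasurable
  rw [Real.rpow_neg_one, norm_kernelInvGrad]

theorem convolutionExists_kernelInvGrad {f : Plane → ℝ} (hf : Integrable f) {C : ℝ}
    (hC : ∀ x, ‖f x‖ ≤ C) :
    ConvolutionExists f kernelInvGrad (ContinuousLinearMap.lsmul ℝ ℝ) volume := by
  intro x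
  set near := (Metric.closedBall (0 : Plane) 1).indicator kernelInvGrad with hnear
  have hnear_int : Integrable near :=
    (locallyIntegrable_kernelInvGrad.integrableOn_isCompact
      (isCompact_closedBall _ _)).integrable_indicator Metric.isClosed_closedBall.measurableSet
  have hsplit : ∀ y, ‖kernelInvGrad y‖ ≤ ‖near y‖ + 1 := by
    intro y
    by_cases hy : y ∈ Metric.closedBall (0 : Plane) 1
    · rw [hnear, indicator_of_mem hy]
      exact le_add_of_nonneg_right zero_le_one
    · have hy_le : 1 ≤ ‖y‖ := (not_le.1 (mem_closedBall_zero_iff.not.1 hy)).le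
      have hπ : (2 * Real.pi)⁻¹ ≤ 1 := inv_le_one_of_one_le₀ (by linarith [Real.pi_gt_three])
      rw [norm_kernelInvGrad]
      exact le_add_of_nonneg_of_le (norm_nonneg _)
        (mul_le_one₀ hπ (by positivity) (inv_le_one_of_one_le₀ hy_le))
  have hdominant : Integrable (fun y => C * ‖near (x - y)‖ + ‖f y‖) :=
    ((hnear_int.comp_sub_left x).norm.const_mul C).add hf.norm
  refine hdominant.mono' (hf.aestronglyMeasurable.smul
    (measurable_kernelInvGrad.comp (measurable_const.sub measurable_id)).aestronglyMeasurable)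
    (Eventually.of_forall fun y => ?_)
  calc ‖f y • kernelInvGrad (x - y)‖ ≤ ‖f y‖ * (‖near (x - y)‖ + 1) := by
        rw [norm_smul]
        exact mul_le_mul_of_nonneg_left (hsplit _) (norm_nonneg _)
    _ ≤ C * ‖near (x - y)‖ + ‖f y‖ := by
        rw [mul_add, mul_one]
        gcongr
        exact hC y

section NormSq

variable {E : Type*} [NormedAddCommGroup E] [InnerProductSpace ℝ E] {F : ℝ → ℝ} {x : E}

theorem hasFDerivAt_comp_norm_sq (hF : DifferentiableAt ℝ F (‖x‖ ^ 2)) :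
    HasFDerivAt (fun y : E => F (‖y‖ ^ 2)) ((2 * deriv F (‖x‖ ^ 2)) • innerSL ℝ x) x := by
  refine (hF.hasDerivAt.comp_hasFDerivAt x
    (hasStrictFDerivAt_norm_sq x).hasFDerivAt).congr_fderiv ?_
  ext y
  simp only [smul_apply, smul_eq_mul, nsmul_eq_mul, Nat.cast_ofNat]
  ring

theorem fderiv_comp_norm_sq_self (hF : DifferentiableAt ℝ F (‖x‖ ^ 2)) :
    fderiv ℝ (fun y : E => F (‖y‖ ^ 2)) x x = 2 * (‖x‖ ^ 2 * deriv F (‖x‖ ^ 2)) := by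
  rw [(hasFDerivAt_comp_norm_sq hF).fderiv, smul_apply, innerSL_apply_apply,
    real_inner_self_eq_norm_sq, smul_eq_mul]
  ring

theorem laplacian_comp_norm_sq [FiniteDimensional ℝ E] (hF : ContDiffAt ℝ 2 F (‖x‖ ^ 2)) :
    Laplacian.laplacian (fun y : E => F (‖y‖ ^ 2)) x
      = 4 * ‖x‖ ^ 2 * deriv (deriv F) (‖x‖ ^ 2)
        + 2 * Module.finrank ℝ E * deriv F (‖x‖ ^ 2) := by
  have hfderiv : fderiv ℝ (fun y : E => F (‖y‖ ^ 2)) =ᶠ[𝓝 x]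
      fun y => (2 * deriv F (‖y‖ ^ 2)) • innerSL ℝ y := by
    have hcont : ContinuousAt (fun y : E => ‖y‖ ^ 2) x := by fun_prop
    filter_upwards [hcont.eventually (hF.eventually (by simp))] with y hy
    exact (hasFDerivAt_comp_norm_sq (hy.differentiableAt two_ne_zero)).fderiv
  have hF' : DifferentiableAt ℝ (deriv F) (‖x‖ ^ 2) :=
    (hF.derivWithin one_add_one_eq_two.le).differentiableAt one_ne_zero
  have hsecond (v : E) : fderiv ℝ (fderiv ℝ (fun y : E => F (‖y‖ ^ 2))) x v v
      = 4 * deriv (deriv F) (‖x‖ ^ 2) * ‖inner ℝ x v‖ ^ 2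
        + 2 * deriv F (‖x‖ ^ 2) * ‖v‖ ^ 2 := by
    have hinner (a b : E) : (innerSL ℝ : E →L[ℝ] E →L[ℝ] ℝ) a b = inner ℝ a b := rfl
    rw [hfderiv.fderiv_eq, (((hasFDerivAt_comp_norm_sq hF').const_mul 2).fun_smul
      (innerSL ℝ).hasFDerivAt).fderiv]
    simp only [add_apply, smul_apply, ContinuousLinearMap.smulRight_apply, hinner,
      smul_eq_mul, real_inner_self_eq_norm_sq, Real.norm_eq_abs, sq_abs]
    ring
  have horthonormal := (stdOrthonormalBasis ℝ E).sum_sq_norm_inner_left x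
  rw [congrFun (InnerProductSpace.laplacian_eq_iteratedFDeriv_stdOrthonormalBasis _) x]
  simp only [iteratedFDeriv_two_apply, Matrix.cons_val_zero, Matrix.cons_val_one, hsecond,
    OrthonormalBasis.norm_eq_one]
  rw [Finset.sum_add_distrib, ← Finset.mul_sum, horthonormal, Finset.sum_const,
    Finset.card_univ, Fintype.card_fin, nsmul_eq_mul]
  ring

end NormSq

theorem divergence_radial_add_perp {P Q : ℝ → ℝ} {x : Plane}
    (hP : DifferentiableAt ℝ P (‖x‖ ^ 2)) (hQ : DifferentiableAt ℝ Q (‖x‖ ^ 2)) :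
    divergence (fun y => P (‖y‖ ^ 2) • y + Q (‖y‖ ^ 2) • perp y) x
      = 2 * P (‖x‖ ^ 2) + 2 * ‖x‖ ^ 2 * deriv P (‖x‖ ^ 2) := by
  have hfderiv : HasFDerivAt (fun y => P (‖y‖ ^ 2) • y + Q (‖y‖ ^ 2) • perp y) _ x :=
    ((hasFDerivAt_comp_norm_sq hP).smul (hasFDerivAt_id x)).add
      ((hasFDerivAt_comp_norm_sq hQ).smul
        perpIsometry.toContinuousLinearEquiv.hasFDerivAt)
  have hnorm : ‖x‖ ^ 2 = x 0 ^ 2 + x 1 ^ 2 := by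
    simp [EuclideanSpace.norm_sq_eq, Fin.sum_univ_two]
  have hperp (y : Plane) : perpIsometry.toContinuousLinearEquiv y = perp y := rfl
  rw [divergence, hfderiv.fderiv]
  simp only [Fin.sum_univ_two, hnorm, hperp, perp, id_eq, add_apply, smul_apply,
    ContinuousLinearMap.id_apply, ContinuousLinearMap.smulRight_apply,
    ContinuousLinearEquiv.coe_coe, coe_innerSL_apply, EuclideanSpace.inner_single_right,
    Real.ringHom_apply, PiLp.single_apply, PiLp.add_apply, PiLp.smul_apply,
    Matrix.cons_val_zero, Matrix.cons_val_one, Matrix.cons_val_fin_one, one_ne_zero, zero_ne_one,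
    ↓reduceIte, smul_eq_mul, one_mul, mul_zero, mul_neg, neg_zero, zero_add]
  ring

theorem IsSelfSimilar.eq_rescale {f : ℝ → Plane → ℝ} (hf : IsSelfSimilar f) {t : ℝ} (ht : 0 < t) :
    f t = rescale (f 1) t := by
  ext x
  have h := hf (Real.sqrt t) (Real.sqrt_pos.2 ht) 1 one_pos ((Real.sqrt t)⁻¹ • x)
  rw [Real.sq_sqrt ht.le, mul_one, smul_inv_smul₀ (Real.sqrt_pos.2 ht).ne'] at h
  rw [rescale, ← h, inv_mul_cancel_left₀ ht.ne']

theorem isSelfSimilar_rescale (W : Plane → ℝ) : IsSelfSimilar (rescale W) := by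
  intro l hl t _ x
  have harg : (Real.sqrt (l ^ 2 * t))⁻¹ • l • x = (Real.sqrt t)⁻¹ • x := by
    rw [Real.sqrt_mul (sq_nonneg l), Real.sqrt_sq hl.le, smul_smul, mul_inv, mul_right_comm,
      inv_mul_cancel₀ hl.ne', one_mul]
  rw [rescale, rescale, harg, mul_inv, ← mul_assoc, ← mul_assoc,
    mul_inv_cancel₀ (pow_ne_zero 2 hl.ne'), one_mul]

theorem rescale_one (W : Plane → ℝ) : rescale W 1 = W := by
  ext x
  simp [rescale]

theorem contDiff_rescale {W : Plane → ℝ} {n : WithTop ℕ∞} (hW : ContDiff ℝ n W) (t : ℝ) :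
    ContDiff ℝ n (rescale W t) :=
  contDiff_const.mul (hW.comp (contDiff_const_smul _))

theorem IsRadial.rescale {W : Plane → ℝ} (hW : IsRadial W) (t : ℝ) :
    IsRadial (rescale W t) := by
  intro x y h
  rw [ExtendedNS.rescale, ExtendedNS.rescale,
    hW ((Real.sqrt t)⁻¹ • x) ((Real.sqrt t)⁻¹ • y) (by rw [norm_smul, norm_smul, h])]

theorem integrable_rescale {W : Plane → ℝ} (hW : Integrable W) {t : ℝ} (ht : 0 < t) :
    Integrable (rescale W t) :=
  ((integrable_comp_smul_iff volume W (inv_ne_zero (Real.sqrt_pos.2 ht).ne')).2 hW).const_mul _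

theorem integral_comp_inv_sqrt_smul {E : Type*} [NormedAddCommGroup E] [NormedSpace ℝ E]
    (g : Plane → E) {t : ℝ} (ht : 0 < t) :
    ∫ x, g ((Real.sqrt t)⁻¹ • x) = t • ∫ x, g x := by
  rw [Measure.integral_comp_smul, finrank_euclideanSpace_fin, inv_pow, inv_inv,
    Real.sq_sqrt ht.le, abs_of_pos ht]

theorem integral_rescale (W : Plane → ℝ) {t : ℝ} (ht : 0 < t) :
    ∫ x, rescale W t x = ∫ x, W x := by
  simp only [rescale]
  rw [integral_const_mul, integral_comp_inv_sqrt_smul W ht, smul_eq_mul,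
    inv_mul_cancel_left₀ ht.ne']

theorem hasDerivAt_rescale {W : Plane → ℝ} (hW : Differentiable ℝ W) {t : ℝ} (ht : 0 < t)
    (x : Plane) :
    HasDerivAt (fun s => rescale W s x)
      (-(t ^ 2)⁻¹ * (W ((Real.sqrt t)⁻¹ • x)
        + fderiv ℝ W ((Real.sqrt t)⁻¹ • x) ((Real.sqrt t)⁻¹ • x) / 2)) t := by
  have hsqrt_pos := Real.sqrt_pos.2 ht
  have hpath : HasDerivAt (fun s => (Real.sqrt s)⁻¹ • x)
      ((-(2 * t)⁻¹) • (Real.sqrt t)⁻¹ • x) t := by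
    rw [smul_smul]
    convert! (((Real.hasDerivAt_sqrt ht.ne').inv hsqrt_pos.ne').smul_const x) using 2
    rw [Real.sq_sqrt ht.le]
    field_simp
  refine ((hasDerivAt_inv ht.ne').mul
    ((hW _).hasFDerivAt.comp_hasDerivAt t hpath)).congr_deriv ?_
  simp only [map_smul, smul_eq_mul, Function.comp_apply]
  field_simp
  ring

theorem laplacian_rescale {W : Plane → ℝ} (hW : ContDiff ℝ 2 W) {t : ℝ} (ht : 0 < t) (x : Plane) :
    Laplacian.laplacian (rescale W t) x
      = (t ^ 2)⁻¹ * Laplacian.laplacian W ((Real.sqrt t)⁻¹ • x) := by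
  have hdilate : ContDiff ℝ 2 (fun y => W ((Real.sqrt t)⁻¹ • y)) :=
    hW.comp (contDiff_const_smul _)
  have hsmul := InnerProductSpace.laplacian_smul t⁻¹ hdilate.contDiffAt (x := x)
  refine hsmul.trans ?_
  simp only [InnerProductSpace.laplacian_eq_iteratedFDeriv_stdOrthonormalBasis,
    iteratedFDeriv_comp_const_smul _ hW, smul_apply, smul_eq_mul]
  rw [inv_pow, Real.sq_sqrt ht.le, ← Finset.mul_sum, ← mul_assoc, ← mul_inv, ← sq]

theorem divergence_const_smul_comp_smul (a c : ℝ) (v : Plane → Plane) (x : Plane) :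
    divergence (fun y => a • v (c • y)) x = a * c * divergence v (c • x) := by
  have hfderiv : fderiv ℝ (fun y => a • v (c • y)) x = a • c • fderiv ℝ v (c • x) := by
    rw [← fderiv_comp_smul]
    exact congrFun (fderiv_const_smul_field (𝕜 := ℝ) (f := fun y => v (c • y)) a) x
  simp only [divergence, hfderiv, smul_apply, PiLp.smul_apply, smul_eq_mul, Finset.mul_sum,
    mul_assoc]

section Convolution

variable {k : Plane → Plane}

theorem rescale_smul_kernel_sub (hk : ∀ c : ℝ, 0 < c → ∀ x, k (c • x) = c⁻¹ • k x)
    (f : Plane → ℝ) {t : ℝ} (ht : 0 < t) (x y : Plane) :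
    rescale f t y • k (x - y) = (t⁻¹ * (Real.sqrt t)⁻¹) •
      f ((Real.sqrt t)⁻¹ • y) • k ((Real.sqrt t)⁻¹ • x - (Real.sqrt t)⁻¹ • y) := by
  have hsqrt_pos := Real.sqrt_pos.2 ht
  rw [← smul_sub, hk _ (inv_pos.2 hsqrt_pos), inv_inv, rescale, smul_smul, smul_smul]
  congr 1
  field_simp

theorem convolutionExists_rescale (hk : ∀ c : ℝ, 0 < c → ∀ x, k (c • x) = c⁻¹ • k x)
    {f : Plane → ℝ} (hf : ConvolutionExists f k (ContinuousLinearMap.lsmul ℝ ℝ) volume)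
    {t : ℝ} (ht : 0 < t) :
    ConvolutionExists (rescale f t) k (ContinuousLinearMap.lsmul ℝ ℝ) volume := by
  intro x
  have hdilate := (integrable_comp_smul_iff volume _ (inv_ne_zero (Real.sqrt_pos.2 ht).ne')).2
    (hf ((Real.sqrt t)⁻¹ • x))
  simp only [ConvolutionExistsAt, ContinuousLinearMap.lsmul_apply,
    rescale_smul_kernel_sub hk f ht x] at hdilate ⊢
  exact hdilate.smul (t⁻¹ * (Real.sqrt t)⁻¹)

theorem convolution_rescale (hk : ∀ c : ℝ, 0 < c → ∀ x, k (c • x) = c⁻¹ • k x)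
    (f : Plane → ℝ) {t : ℝ} (ht : 0 < t) (x : Plane) :
    convolution (rescale f t) k (ContinuousLinearMap.lsmul ℝ ℝ) volume x
      = (Real.sqrt t)⁻¹ •
        convolution f k (ContinuousLinearMap.lsmul ℝ ℝ) volume ((Real.sqrt t)⁻¹ • x) := by
  simp only [convolution, ContinuousLinearMap.lsmul_apply, rescale_smul_kernel_sub hk f ht x]
  rw [integral_smul, integral_comp_inv_sqrt_smul
    (fun y => f y • k ((Real.sqrt t)⁻¹ • x - y)) ht, smul_smul]
  congr 1
  field_simp

end Convolution

theorem kernelInvGrad_smul (c : ℝ) (hc : 0 < c) (x : Plane) :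
    kernelInvGrad (c • x) = c⁻¹ • kernelInvGrad x := by
  rw [kernelInvGrad, kernelInvGrad, norm_smul, Real.norm_of_nonneg hc.le, smul_smul, smul_smul]
  congr 1
  field_simp

theorem kernelBS_smul (c : ℝ) (hc : 0 < c) (x : Plane) :
    kernelBS (c • x) = c⁻¹ • kernelBS x := by
  rw [kernelBS_eq_perp, kernelBS_eq_perp, kernelInvGrad_smul c hc, perp_smul]

theorem velocity_rescale (W Q : Plane → ℝ) {t : ℝ} (ht : 0 < t) (x : Plane) :
    velocity (rescale W t) (rescale Q t) x
      = (Real.sqrt t)⁻¹ • velocity W Q ((Real.sqrt t)⁻¹ • x) := by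
  simp only [velocity, biotSavart, invGrad]
  rw [convolution_rescale kernelBS_smul W ht, convolution_rescale kernelInvGrad_smul Q ht,
    smul_add]

theorem divergence_rescale_smul_velocity (W Q : Plane → ℝ) {t : ℝ} (ht : 0 < t) (x : Plane) :
    divergence (fun y => rescale W t y • velocity (rescale W t) (rescale Q t) y) x
      = (t ^ 2)⁻¹ * divergence (fun y => W y • velocity W Q y) ((Real.sqrt t)⁻¹ • x) := by
  have hfield : (fun y => rescale W t y • velocity (rescale W t) (rescale Q t) y)
      = fun y => (t⁻¹ * (Real.sqrt t)⁻¹) •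
        (fun z => W z • velocity W Q z) ((Real.sqrt t)⁻¹ • y) := by
    ext1 y
    rw [velocity_rescale W Q ht, rescale, smul_smul, smul_smul, mul_right_comm]
  have hcoeff : t⁻¹ * (Real.sqrt t)⁻¹ * (Real.sqrt t)⁻¹ = (t ^ 2)⁻¹ := by
    rw [mul_assoc, ← mul_inv, Real.mul_self_sqrt ht.le, ← mul_inv, ← sq]
  rw [hfield, divergence_const_smul_comp_smul _ _ fun z => W z • velocity W Q z, hcoeff]

/-- The system in the self-similar variables `x / √t`: the pair `(W, Q)` is the profile at time one
of a self-similar solution, the time derivatives having become `-(1 + x · ∇ / 2)`. -/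
structure IsSelfSimilarProfile (W Q : Plane → ℝ) : Prop where
  contDiff_vorticity : ContDiff ℝ 2 W
  contDiff_div : ContDiff ℝ 2 Q
  convolutionExists_vorticity :
    ConvolutionExists W kernelBS (ContinuousLinearMap.lsmul ℝ ℝ) volume
  convolutionExists_div :
    ConvolutionExists Q kernelInvGrad (ContinuousLinearMap.lsmul ℝ ℝ) volume
  differentiable_velocity : Differentiable ℝ (velocity W Q)
  vorticity_eq : ∀ x, -(W x + fderiv ℝ W x x / 2) + divergence (fun y => W y • velocity W Q y) x
    = Laplacian.laplacian W x
  div_eq : ∀ x, -(Q x + fderiv ℝ Q x x / 2) = Laplacian.laplacian Q x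

theorem IsSelfSimilar.hasDerivAt {f : ℝ → Plane → ℝ} (hf : IsSelfSimilar f)
    (hf_diff : Differentiable ℝ (f 1)) {t : ℝ} (ht : 0 < t) (x : Plane) :
    HasDerivAt (fun s => f s x) ((t ^ 2)⁻¹ * -(f 1 ((Real.sqrt t)⁻¹ • x)
      + fderiv ℝ (f 1) ((Real.sqrt t)⁻¹ • x) ((Real.sqrt t)⁻¹ • x) / 2)) t := by
  rw [mul_neg, ← neg_mul]
  refine (hasDerivAt_rescale hf_diff ht x).congr_of_eventuallyEq ?_
  filter_upwards [Ioi_mem_nhds ht] with s hs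
  rw [hf.eq_rescale hs]

theorem IsSolution.isSelfSimilarProfile {ω d : ℝ → Plane → ℝ} (h : IsSolution ω d)
    (hω : IsSelfSimilar ω) (hd : IsSelfSimilar d) : IsSelfSimilarProfile (ω 1) (d 1) where
  contDiff_vorticity := h.contDiff_vorticity 1 one_pos
  contDiff_div := h.contDiff_div 1 one_pos
  convolutionExists_vorticity := h.convolutionExists_vorticity 1 one_pos
  convolutionExists_div := h.convolutionExists_div 1 one_pos
  differentiable_velocity := h.differentiable_velocity 1 one_pos
  vorticity_eq x := by
    have hdiff := (h.contDiff_vorticity 1 one_pos).differentiable two_ne_zero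
    have heq := h.vorticity_eq 1 one_pos x
    rw [(hω.hasDerivAt hdiff one_pos x).deriv] at heq
    simpa only [one_pow, inv_one, one_mul, Real.sqrt_one, one_smul] using heq
  div_eq x := by
    have hdiff := (h.contDiff_div 1 one_pos).differentiable two_ne_zero
    have heq := h.div_eq 1 one_pos x
    rw [(hd.hasDerivAt hdiff one_pos x).deriv] at heq
    simpa only [one_pow, inv_one, one_mul, Real.sqrt_one, one_smul] using heq

theorem IsSelfSimilarProfile.isSolution {ω d : ℝ → Plane → ℝ}
    (h : IsSelfSimilarProfile (ω 1) (d 1)) (hω : IsSelfSimilar ω) (hd : IsSelfSimilar d) :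
    IsSolution ω d := by
  have hω_diff := h.contDiff_vorticity.differentiable two_ne_zero
  have hd_diff := h.contDiff_div.differentiable two_ne_zero
  refine
    { contDiff_vorticity := fun t ht => ?_
      contDiff_div := fun t ht => ?_
      differentiableAt_vorticity := fun t ht x => (hω.hasDerivAt hω_diff ht x).differentiableAt
      differentiableAt_div := fun t ht x => (hd.hasDerivAt hd_diff ht x).differentiableAt
      convolutionExists_vorticity := fun t ht => ?_
      convolutionExists_div := fun t ht => ?_
      differentiable_velocity := fun t ht => ?_
      vorticity_eq := fun t ht x => ?_
      div_eq := fun t ht x => ?_ }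
  · exact hω.eq_rescale ht ▸ contDiff_rescale h.contDiff_vorticity t
  · exact hd.eq_rescale ht ▸ contDiff_rescale h.contDiff_div t
  · exact hω.eq_rescale ht ▸
      convolutionExists_rescale kernelBS_smul h.convolutionExists_vorticity ht
  · exact hd.eq_rescale ht ▸
      convolutionExists_rescale kernelInvGrad_smul h.convolutionExists_div ht
  · rw [hω.eq_rescale ht, hd.eq_rescale ht, funext (velocity_rescale _ _ ht)]
    exact (h.differentiable_velocity.comp (differentiable_id.const_smul (Real.sqrt t)⁻¹)).const_smul
      (Real.sqrt t)⁻¹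
  · rw [(hω.hasDerivAt hω_diff ht x).deriv, hω.eq_rescale ht, hd.eq_rescale ht,
      divergence_rescale_smul_velocity _ _ ht, laplacian_rescale h.contDiff_vorticity ht,
      ← mul_add, h.vorticity_eq]
  · rw [(hd.hasDerivAt hd_diff ht x).deriv, hd.eq_rescale ht,
      laplacian_rescale h.contDiff_div ht, h.div_eq]

/-- For `W x = F (‖x‖ ^ 2)` and a velocity with divergence `D (‖x‖ ^ 2)`, the outward flux of
`∇W + (x / 2 - u) W` through the circle `‖x‖ ^ 2 = s`, divided by `π`. The profile equation for `W`
says that this field is divergence free. -/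
noncomputable def radialFlux (D F : ℝ → ℝ) (s : ℝ) : ℝ :=
  4 * s * deriv F s + (s - ∫ u in (0 : ℝ)..s, D u) * F s

theorem hasDerivAt_radialFlux {D F : ℝ → ℝ} (hD : Continuous D) {s : ℝ}
    (hF : ContDiffAt ℝ 2 F s) :
    HasDerivAt (radialFlux D F) (4 * s * deriv (deriv F) s + 4 * deriv F s
      + (F s + s * deriv F s) - (deriv F s * (∫ u in (0 : ℝ)..s, D u) + F s * D s)) s := by
  have hF' : HasDerivAt F (deriv F s) s := (hF.differentiableAt two_ne_zero).hasDerivAt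
  have hF'' : HasDerivAt (deriv F) (deriv (deriv F) s) s :=
    ((hF.derivWithin one_add_one_eq_two.le).differentiableAt one_ne_zero).hasDerivAt
  refine ((((hasDerivAt_id s).const_mul 4).mul hF'').add
    (((hasDerivAt_id s).sub (hD.integral_hasStrictDerivAt 0 s).hasDerivAt).mul hF')).congr_deriv ?_
  simp only [id, Pi.sub_apply]
  ring

theorem laplacian_add_eq_deriv_radialFlux {D : ℝ → ℝ} {x : Plane}
    (hD : ContDiffAt ℝ 2 D (‖x‖ ^ 2)) :
    Laplacian.laplacian (fun y : Plane => D (‖y‖ ^ 2)) x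
        + (D (‖x‖ ^ 2) + fderiv ℝ (fun y : Plane => D (‖y‖ ^ 2)) x x / 2)
      = deriv (radialFlux 0 D) (‖x‖ ^ 2) := by
  rw [laplacian_comp_norm_sq hD, finrank_euclideanSpace_fin,
    fderiv_comp_norm_sq_self (hD.differentiableAt two_ne_zero),
    (hasDerivAt_radialFlux continuous_zero hD).deriv]
  simp only [Pi.zero_apply, intervalIntegral.integral_zero, Nat.cast_ofNat]
  ring

section Velocity

variable {F D : ℝ → ℝ} (hF : Continuous F) (hD : Continuous D)
  (hF_conv : ConvolutionExists (fun y : Plane => F (‖y‖ ^ 2)) kernelBS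
    (ContinuousLinearMap.lsmul ℝ ℝ) volume)
  (hD_conv : ConvolutionExists (fun y : Plane => D (‖y‖ ^ 2)) kernelInvGrad
    (ContinuousLinearMap.lsmul ℝ ℝ) volume)

include hF hD hF_conv hD_conv

theorem divergence_smul_velocity_comp_norm_sq {x : Plane}
    (hF_diff : DifferentiableAt ℝ F (‖x‖ ^ 2))
    (hF_avg : DifferentiableAt ℝ (segmentAverage F) (‖x‖ ^ 2))
    (hD_avg : DifferentiableAt ℝ (segmentAverage D) (‖x‖ ^ 2)) :
    divergence (fun y => F (‖y‖ ^ 2) •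
        velocity (fun z => F (‖z‖ ^ 2)) (fun z => D (‖z‖ ^ 2)) y) x
      = deriv F (‖x‖ ^ 2) * (∫ u in (0 : ℝ)..‖x‖ ^ 2, D u) + F (‖x‖ ^ 2) * D (‖x‖ ^ 2) := by
  have hfield : (fun y => F (‖y‖ ^ 2) •
      velocity (fun z => F (‖z‖ ^ 2)) (fun z => D (‖z‖ ^ 2)) y) = fun y : Plane =>
        (F * fun s => segmentAverage D s / 2) (‖y‖ ^ 2) • y
          + (F * fun s => segmentAverage F s / 2) (‖y‖ ^ 2) • perp y := by
    ext1 y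
    rw [velocity_comp_norm_sq hF hD (hF_conv y) (hD_conv y), smul_add, smul_smul, smul_smul]
    rfl
  rw [hfield, divergence_radial_add_perp (hF_diff.mul (hD_avg.div_const 2))
    (hF_diff.mul (hF_avg.div_const 2)), deriv_mul hF_diff (hD_avg.div_const 2),
    deriv_div_const, ← mul_segmentAverage, ← segmentAverage_add_mul_deriv hD hD_avg]
  simp only [Pi.mul_apply]
  ring

theorem laplacian_add_sub_divergence_eq_deriv_radialFlux {x : Plane}
    (hF_diff : ContDiffAt ℝ 2 F (‖x‖ ^ 2))
    (hF_avg : DifferentiableAt ℝ (segmentAverage F) (‖x‖ ^ 2))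
    (hD_avg : DifferentiableAt ℝ (segmentAverage D) (‖x‖ ^ 2)) :
    Laplacian.laplacian (fun y : Plane => F (‖y‖ ^ 2)) x
        + (F (‖x‖ ^ 2) + fderiv ℝ (fun y : Plane => F (‖y‖ ^ 2)) x x / 2)
        - divergence (fun y => F (‖y‖ ^ 2) •
          velocity (fun z => F (‖z‖ ^ 2)) (fun z => D (‖z‖ ^ 2)) y) x
      = deriv (radialFlux D F) (‖x‖ ^ 2) := by
  have hF_diff' := hF_diff.differentiableAt two_ne_zero
  rw [divergence_smul_velocity_comp_norm_sq hF hD hF_conv hD_conv hF_diff' hF_avg hD_avg,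
    laplacian_comp_norm_sq hF_diff, finrank_euclideanSpace_fin, fderiv_comp_norm_sq_self hF_diff',
    (hasDerivAt_radialFlux hD hF_diff).deriv, Nat.cast_ofNat]
  ring

end Velocity

theorem isSelfSimilarProfile_comp_norm_sq {F D : ℝ → ℝ} (hF : ContDiff ℝ 2 F)
    (hD : ContDiff ℝ 2 D)
    (hF_conv : ConvolutionExists (fun y : Plane => F (‖y‖ ^ 2)) kernelBS
      (ContinuousLinearMap.lsmul ℝ ℝ) volume)
    (hD_conv : ConvolutionExists (fun y : Plane => D (‖y‖ ^ 2)) kernelInvGrad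
      (ContinuousLinearMap.lsmul ℝ ℝ) volume)
    (hF_flux : radialFlux D F = 0) (hD_flux : radialFlux 0 D = 0) :
    IsSelfSimilarProfile (fun x => F (‖x‖ ^ 2)) (fun x => D (‖x‖ ^ 2)) := by
  have hF_avg : Differentiable ℝ (segmentAverage F) :=
    (contDiff_segmentAverage (hF.of_le one_le_two)).differentiable one_ne_zero
  have hD_avg : Differentiable ℝ (segmentAverage D) :=
    (contDiff_segmentAverage (hD.of_le one_le_two)).differentiable one_ne_zero
  refine
    { contDiff_vorticity := hF.comp (contDiff_norm_sq ℝ)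
      contDiff_div := hD.comp (contDiff_norm_sq ℝ)
      convolutionExists_vorticity := hF_conv
      convolutionExists_div := hD_conv
      differentiable_velocity := ?_
      vorticity_eq := fun x => ?_
      div_eq := fun x => ?_ }
  · have hnorm_sq : Differentiable ℝ (fun x : Plane => ‖x‖ ^ 2) :=
      (contDiff_norm_sq ℝ (n := 1)).differentiable one_ne_zero
    have hvelocity := funext fun x =>
      velocity_comp_norm_sq hF.continuous hD.continuous (hF_conv x) (hD_conv x)
    rw [show velocity _ _ = _ from hvelocity]
    have hcoeff {A : ℝ → ℝ} (hA : Differentiable ℝ A) :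
        Differentiable ℝ fun x : Plane => A (‖x‖ ^ 2) / 2 := by fun_prop
    exact ((hcoeff hD_avg).smul differentiable_id).add
      ((hcoeff hF_avg).smul perpIsometry.toContinuousLinearEquiv.differentiable)
  · have hflux := laplacian_add_sub_divergence_eq_deriv_radialFlux hF.continuous hD.continuous
      hF_conv hD_conv (x := x) hF.contDiffAt (hF_avg _) (hD_avg _)
    rw [hF_flux, deriv_zero, Pi.zero_apply] at hflux
    linear_combination -hflux
  · have hflux := laplacian_add_eq_deriv_radialFlux (x := x) hD.contDiffAt
    rw [hD_flux, deriv_zero, Pi.zero_apply] at hflux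
    linear_combination -hflux

/-- The unit vector spanning the ray along which radial functions are sampled. -/
noncomputable def rayDirection : Plane := EuclideanSpace.single 0 1

theorem norm_sqrt_smul_rayDirection (s : ℝ) : ‖√s • rayDirection‖ = √s := by
  simp [rayDirection, norm_smul]

theorem norm_sq_sqrt_smul_rayDirection {s : ℝ} (hs : 0 ≤ s) : ‖√s • rayDirection‖ ^ 2 = s := by
  rw [norm_sqrt_smul_rayDirection, Real.sq_sqrt hs]

theorem sqrt_smul_rayDirection_ne_zero {s : ℝ} (hs : 0 < s) : √s • rayDirection ≠ 0 := by
  rw [← norm_ne_zero_iff, norm_sqrt_smul_rayDirection]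
  exact (Real.sqrt_pos.2 hs).ne'

/-- A radial function as a function of `s = ‖x‖ ^ 2`. -/
noncomputable def radialPart (f : Plane → ℝ) (s : ℝ) : ℝ := f (√s • rayDirection)

theorem IsRadial.eq_radialPart {f : Plane → ℝ} (hf : IsRadial f) :
    f = fun x => radialPart f (‖x‖ ^ 2) := by
  ext x
  refine hf _ _ ?_
  rw [norm_sqrt_smul_rayDirection, Real.sqrt_sq (norm_nonneg x)]

theorem continuous_radialPart {f : Plane → ℝ} (hf : Continuous f) : Continuous (radialPart f) := by
  unfold radialPart
  fun_prop

theorem hasDerivAt_radialPart {f : Plane → ℝ} {s : ℝ} (hs : 0 < s)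
    (hf : DifferentiableAt ℝ f (√s • rayDirection)) :
    HasDerivAt (radialPart f) (fderiv ℝ f (√s • rayDirection) rayDirection / (2 * √s)) s := by
  refine (hf.hasFDerivAt.comp_hasDerivAt s
    ((Real.hasDerivAt_sqrt hs.ne').smul_const rayDirection)).congr_deriv ?_
  rw [map_smul, smul_eq_mul]
  ring

theorem contDiffAt_radialPart {f : Plane → ℝ} {n : WithTop ℕ∞} (hf : ContDiff ℝ n f) {s : ℝ}
    (hs : 0 < s) : ContDiffAt ℝ n (radialPart f) s :=
  hf.contDiffAt.comp s ((Real.contDiffAt_sqrt hs.ne').smul contDiffAt_const)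

theorem tendsto_mul_deriv_radialPart {f : Plane → ℝ} (hf : ContDiff ℝ 1 f) :
    Tendsto (fun s => s * deriv (radialPart f) s) (𝓝[>] 0) (𝓝 0) := by
  have hcont : Continuous fun s : ℝ => √s * fderiv ℝ f (√s • rayDirection) rayDirection / 2 := by
    have := hf.continuous_fderiv one_ne_zero
    fun_prop
  have hlim := (hcont.tendsto 0).mono_left (nhdsWithin_le_nhds (s := Ioi (0 : ℝ)))
  simp only [Real.sqrt_zero, zero_mul, zero_div] at hlim
  refine hlim.congr' ?_
  filter_upwards [self_mem_nhdsWithin] with s hs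
  have hsqrt : √s ≠ 0 := (Real.sqrt_pos.2 hs).ne'
  rw [(hasDerivAt_radialPart hs (hf.differentiable one_ne_zero _)).deriv]
  field_simp
  rw [Real.sq_sqrt (le_of_lt hs), mul_comm]

theorem eq_of_hasDerivAt_zero_Ioi {Φ : ℝ → ℝ} {a : ℝ} (h : ∀ s, a < s → HasDerivAt Φ 0 s)
    {s u : ℝ} (hs : a < s) (hu : a < u) : Φ s = Φ u :=
  isOpen_Ioi.is_const_of_deriv_eq_zero isPreconnected_Ioi
    (fun x hx => (h x hx).differentiableAt.differentiableWithinAt)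
    (fun x hx => (h x hx).deriv) hs hu

theorem eq_of_hasDerivAt_zero_of_tendsto {Φ : ℝ → ℝ} {a c : ℝ}
    (h : ∀ s, a < s → HasDerivAt Φ 0 s) (hlim : Tendsto Φ (𝓝[>] a) (𝓝 c)) {s : ℝ} (hs : a < s) :
    Φ s = c := by
  refine tendsto_nhds_unique (tendsto_const_nhds.congr' ?_) hlim
  filter_upwards [self_mem_nhdsWithin] with u hu
  exact eq_of_hasDerivAt_zero_Ioi h hs hu

theorem radialFlux_radialPart_eq_zero {D : ℝ → ℝ} {f : Plane → ℝ} (hD : Continuous D)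
    (hf : ContDiff ℝ 2 f) (h : ∀ s, 0 < s → deriv (radialFlux D (radialPart f)) s = 0)
    {s : ℝ} (hs : 0 < s) : radialFlux D (radialPart f) s = 0 := by
  have hderiv : ∀ u, 0 < u → HasDerivAt (radialFlux D (radialPart f)) 0 u := fun u hu =>
    h u hu ▸ (hasDerivAt_radialFlux hD (contDiffAt_radialPart hf hu)).differentiableAt.hasDerivAt
  refine eq_of_hasDerivAt_zero_of_tendsto hderiv ?_ hs
  have hdiffusive : Tendsto (fun u => 4 * u * deriv (radialPart f) u) (𝓝[>] 0) (𝓝 0) := by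
    simpa only [mul_assoc, mul_zero] using
      (tendsto_mul_deriv_radialPart (hf.of_le one_le_two)).const_mul 4
  have hdrift : Continuous fun u => (u - ∫ v in (0 : ℝ)..u, D v) * radialPart f u := by
    have := continuous_radialPart hf.continuous
    have := intervalIntegral.continuous_primitive (μ := volume) (hD.intervalIntegrable) 0
    fun_prop
  have hdrift_lim := (hdrift.tendsto 0).mono_left (nhdsWithin_le_nhds (s := Ioi (0 : ℝ)))
  simp only [intervalIntegral.integral_same, sub_zero, zero_mul] at hdrift_lim
  have hlim := hdiffusive.add hdrift_lim
  rwa [add_zero] at hlim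

theorem IsSelfSimilarProfile.radialFlux_div_eq_zero {W Q : Plane → ℝ}
    (h : IsSelfSimilarProfile W Q) (hQ : IsRadial Q) {s : ℝ} (hs : 0 < s) :
    radialFlux 0 (radialPart Q) s = 0 := by
  refine radialFlux_radialPart_eq_zero continuous_zero h.contDiff_div (fun u hu => ?_) hs
  have hu_sq := norm_sq_sqrt_smul_rayDirection hu.le
  have hQ_diff := contDiffAt_radialPart h.contDiff_div hu
  have hflux := laplacian_add_eq_deriv_radialFlux (hu_sq.symm ▸ hQ_diff)
  have heq := h.div_eq (√u • rayDirection)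
  rw [hQ.eq_radialPart] at heq
  simp only [← heq, hu_sq] at hflux
  linear_combination -hflux

theorem IsSelfSimilarProfile.radialFlux_vorticity_eq_zero {W Q : Plane → ℝ}
    (h : IsSelfSimilarProfile W Q) (hW : IsRadial W) (hQ : IsRadial Q) {s : ℝ} (hs : 0 < s) :
    radialFlux (radialPart Q) (radialPart W) s = 0 := by
  have hQ_cont := continuous_radialPart h.contDiff_div.continuous
  have hW_cont := continuous_radialPart h.contDiff_vorticity.continuous
  refine radialFlux_radialPart_eq_zero hQ_cont h.contDiff_vorticity (fun u hu => ?_) hs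
  have hu_sq := norm_sq_sqrt_smul_rayDirection hu.le
  have hW_diff := contDiffAt_radialPart h.contDiff_vorticity hu
  have hflux := laplacian_add_sub_divergence_eq_deriv_radialFlux hW_cont hQ_cont
    (hW.eq_radialPart ▸ h.convolutionExists_vorticity)
    (hQ.eq_radialPart ▸ h.convolutionExists_div) (hu_sq.symm ▸ hW_diff)
    (differentiableAt_segmentAverage_of_ne_zero hW_cont (hu_sq.symm ▸ hu.ne'))
    (differentiableAt_segmentAverage_of_ne_zero hQ_cont (hu_sq.symm ▸ hu.ne'))
  have heq := h.vorticity_eq (√u • rayDirection)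
  rw [hW.eq_radialPart, hQ.eq_radialPart] at heq
  simp only [← heq, hu_sq] at hflux
  linear_combination -hflux

theorem exists_forall_le_of_antitoneOn_Ici {g : ℝ → ℝ} {a b : ℝ} (hg : ContinuousOn g (Icc a b))
    (hab : a ≤ b) (hg_anti : AntitoneOn g (Ici b)) : ∃ C, ∀ s, a ≤ s → g s ≤ C := by
  obtain ⟨C, hC⟩ := isCompact_Icc.bddAbove_image hg
  refine ⟨C, fun s hs => ?_⟩
  rcases le_total s b with hsb | hbs
  · exact hC (mem_image_of_mem g ⟨hs, hsb⟩)
  · exact (hg_anti self_mem_Ici hbs hbs).trans (hC (mem_image_of_mem g ⟨hab, le_rfl⟩))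

/-- The solution of `radialFlux D F = 0` with `F 0 = 1`. For a velocity with radial divergence `D`
it is the unnormalized stationary density, as a function of `s = ‖x‖ ^ 2`, of the diffusion
confined by the drift `-x / 2`. -/
noncomputable def driftShape (D : ℝ → ℝ) (s : ℝ) : ℝ :=
  Real.exp (((∫ u in (0 : ℝ)..s, segmentAverage D u) - s) / 4)

theorem driftShape_pos (D : ℝ → ℝ) (s : ℝ) : 0 < driftShape D s := Real.exp_pos _

theorem driftShape_zero (s : ℝ) : driftShape 0 s = Real.exp (-s / 4) := by
  simp [driftShape, segmentAverage_zero_left]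

section DriftShape

variable {D : ℝ → ℝ}

theorem hasDerivAt_driftShape (hD : Continuous D) (s : ℝ) :
    HasDerivAt (driftShape D) ((segmentAverage D s - 1) / 4 * driftShape D s) s := by
  have hexponent :=
    ((((continuous_segmentAverage hD).integral_hasStrictDerivAt 0 s).hasDerivAt).sub
      (hasDerivAt_id s)).div_const 4
  exact hexponent.exp.congr_deriv (mul_comm _ _)

theorem continuous_driftShape (hD : Continuous D) : Continuous (driftShape D) :=
  continuous_iff_continuousAt.2 fun s => (hasDerivAt_driftShape hD s).continuousAt

theorem contDiff_driftShape (hD : ContDiff ℝ 1 D) : ContDiff ℝ 2 (driftShape D) := by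
  have hderiv := hasDerivAt_driftShape hD.continuous
  have havg := contDiff_segmentAverage hD
  have hC1 : ContDiff ℝ 1 (driftShape D) := by
    refine contDiff_one_iff_deriv.2 ⟨fun s => (hderiv s).differentiableAt, ?_⟩
    have := havg.continuous
    have := continuous_driftShape hD.continuous
    rw [funext fun s => (hderiv s).deriv]
    fun_prop
  rw [← one_add_one_eq_two, contDiff_succ_iff_deriv]
  refine ⟨fun s => (hderiv s).differentiableAt, by simp, ?_⟩
  rw [funext fun s => (hderiv s).deriv]
  fun_prop

theorem radialFlux_const_mul_driftShape (hD : Continuous D) (c : ℝ) :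
    radialFlux D (fun s => c * driftShape D s) = 0 := by
  ext s
  rw [radialFlux, ((hasDerivAt_driftShape hD s).const_mul c).deriv, ← mul_segmentAverage,
    Pi.zero_apply]
  ring

theorem exists_eq_mul_driftShape {F : ℝ → ℝ} (hD : Continuous D) (hF : Continuous F)
    (hF_diff : ∀ s, 0 < s → DifferentiableAt ℝ F s)
    (h : ∀ s, 0 < s → radialFlux D F s = 0) :
    ∃ c, ∀ s, 0 ≤ s → F s = c * driftShape D s := by
  have hF_deriv : ∀ s, 0 < s → deriv F s = (segmentAverage D s - 1) / 4 * F s := by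
    intro s hs
    have hflux := h s hs
    rw [radialFlux, ← mul_segmentAverage] at hflux
    refine mul_left_cancel₀ (mul_ne_zero four_ne_zero hs.ne') ?_
    linear_combination hflux
  have hquot : ∀ s, 0 < s → HasDerivAt (fun s => F s / driftShape D s) 0 s := by
    intro s hs
    refine ((hF_diff s hs).hasDerivAt.div (hasDerivAt_driftShape hD s)
      (driftShape_pos D s).ne').congr_deriv ?_
    rw [hF_deriv s hs]
    ring
  have heq : EqOn F (fun s => F 1 / driftShape D 1 * driftShape D s) (Ioi 0) := fun s hs =>
    (div_eq_iff (driftShape_pos D s).ne').1 (eq_of_hasDerivAt_zero_Ioi hquot hs one_pos)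
  have hclosure := heq.closure hF (continuous_const.mul (continuous_driftShape hD))
  rw [closure_Ioi] at hclosure
  exact ⟨_, fun s hs => hclosure hs⟩

theorem exists_driftShape_le (hD : Continuous D) {M : ℝ}
    (hM : ∀ s, 0 ≤ s → ∫ u in (0 : ℝ)..s, D u ≤ M) :
    ∃ C, ∀ s, 0 ≤ s → driftShape D s ≤ C * Real.exp (-(1 / 8) * s) := by
  set g : ℝ → ℝ := fun s => driftShape D s * Real.exp (s / 8) with hg
  have hg_deriv (s : ℝ) : HasDerivAt g ((segmentAverage D s / 4 - 1 / 8) * g s) s := by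
    refine ((hasDerivAt_driftShape hD s).mul
      ((hasDerivAt_id s).div_const 8).exp).congr_deriv ?_
    simp only [hg, id]
    ring
  have hg_cont : Continuous g := continuous_iff_continuousAt.2 fun s => (hg_deriv s).continuousAt
  -- Beyond `2 * M` the average of `D` is at most `1 / 2`, so that `g` decreases.
  have hg_anti : AntitoneOn g (Ici (max (2 * M) 0)) := by
    refine antitoneOn_of_deriv_nonpos (convex_Ici _) hg_cont.continuousOn
      (fun s _ => (hg_deriv s).differentiableAt.differentiableWithinAt) fun s hs => ?_
    rw [interior_Ici, mem_Ioi, max_lt_iff] at hs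
    have havg : s * segmentAverage D s ≤ s * (1 / 2) := by
      rw [mul_segmentAverage]
      linarith [hM s hs.2.le]
    rw [(hg_deriv s).deriv]
    exact mul_nonpos_of_nonpos_of_nonneg (by linarith [le_of_mul_le_mul_left havg hs.2])
      (mul_pos (driftShape_pos D s) (Real.exp_pos _)).le
  obtain ⟨C, hC⟩ := exists_forall_le_of_antitoneOn_Ici hg_cont.continuousOn (le_max_right _ _)
    hg_anti
  refine ⟨C, fun s hs => ?_⟩
  have hexp : driftShape D s = g s * Real.exp (-(1 / 8) * s) := by
    rw [hg, mul_assoc, ← Real.exp_add, show s / 8 + -(1 / 8) * s = 0 by ring, Real.exp_zero,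
      mul_one]
  exact hexp ▸ mul_le_mul_of_nonneg_right (hC s hs) (Real.exp_pos _).le

end DriftShape

theorem integrable_exp_neg_mul_norm_sq {V : Type*} [NormedAddCommGroup V] [InnerProductSpace ℝ V]
    [FiniteDimensional ℝ V] [MeasurableSpace V] [BorelSpace V] {a : ℝ} (ha : 0 < a) :
    Integrable (fun x : V => Real.exp (-a * ‖x‖ ^ 2)) := by
  refine Integrable.of_integral_ne_zero ?_
  rw [GaussianFourier.integral_rexp_neg_mul_sq_norm ha]
  positivity

section Mass

variable {D : ℝ → ℝ} (hD : Continuous D) {M : ℝ}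
  (hM : ∀ s, 0 ≤ s → ∫ u in (0 : ℝ)..s, D u ≤ M)

include hD hM

theorem integrable_driftShape_norm_sq : Integrable fun x : Plane => driftShape D (‖x‖ ^ 2) := by
  obtain ⟨C, hC⟩ := exists_driftShape_le hD hM
  have hcont := continuous_driftShape hD
  refine ((integrable_exp_neg_mul_norm_sq (a := 1 / 8) (by norm_num)).const_mul C).mono'
    (by fun_prop : Continuous _).aestronglyMeasurable (Eventually.of_forall fun x => ?_)
  rw [Real.norm_of_nonneg (driftShape_pos _ _).le]
  exact hC _ (sq_nonneg _)

theorem integral_driftShape_norm_sq_pos : 0 < ∫ x : Plane, driftShape D (‖x‖ ^ 2) := by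
  have hsupport : Function.support (fun x : Plane => driftShape D (‖x‖ ^ 2)) = univ :=
    eq_univ_of_forall fun _ => (driftShape_pos D _).ne'
  rw [integral_pos_iff_support_of_nonneg (fun _ => (driftShape_pos _ _).le)
    (integrable_driftShape_norm_sq hD hM), hsupport]
  simp

theorem convolutionExists_driftShape_norm_sq (c : ℝ) :
    ConvolutionExists (fun x : Plane => c * driftShape D (‖x‖ ^ 2)) kernelInvGrad
      (ContinuousLinearMap.lsmul ℝ ℝ) volume := by
  obtain ⟨C, hC⟩ := exists_driftShape_le hD hM
  have hC_nonneg : 0 ≤ C := by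
    simpa using (driftShape_pos D 0).le.trans (hC 0 le_rfl)
  refine convolutionExists_kernelInvGrad ((integrable_driftShape_norm_sq hD hM).const_mul c)
    (C := |c| * C) fun x => ?_
  rw [norm_mul, Real.norm_of_nonneg (driftShape_pos _ _).le, Real.norm_eq_abs]
  refine mul_le_mul_of_nonneg_left ((hC _ (sq_nonneg _)).trans ?_) (abs_nonneg c)
  exact mul_le_of_le_one_right hC_nonneg (Real.exp_le_one_iff.2 (by nlinarith [sq_nonneg ‖x‖]))

end Mass

/-- The Gaussian of mass `β` on the plane as a function of `s = ‖x‖ ^ 2`. -/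
noncomputable def gaussianShape (β s : ℝ) : ℝ := β / (4 * Real.pi) * Real.exp (-s / 4)

theorem mul_gaussian (β : ℝ) (x : Plane) : β * gaussian x = gaussianShape β (‖x‖ ^ 2) := by
  rw [gaussian, gaussianShape, ← mul_assoc, div_eq_mul_inv β]

theorem gaussianShape_eq_mul_driftShape (β : ℝ) :
    gaussianShape β = fun s => β / (4 * Real.pi) * driftShape 0 s := by
  ext s
  rw [gaussianShape, driftShape_zero]

theorem contDiff_gaussianShape (β : ℝ) {n : WithTop ℕ∞} : ContDiff ℝ n (gaussianShape β) := by
  unfold gaussianShape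
  fun_prop

theorem continuous_gaussianShape (β : ℝ) : Continuous (gaussianShape β) :=
  (contDiff_gaussianShape β (n := 0)).continuous

theorem integral_gaussianShape (β s : ℝ) :
    ∫ u in (0 : ℝ)..s, gaussianShape β u = β / Real.pi * (1 - Real.exp (-s / 4)) := by
  have hderiv : ∀ u ∈ uIcc 0 s, HasDerivAt (fun u => β / Real.pi * (1 - Real.exp (-u / 4)))
      (gaussianShape β u) u := by
    intro u _
    refine (((((hasDerivAt_id u).neg).div_const 4).exp.const_sub 1).const_mul _).congr_deriv ?_
    simp only [gaussianShape, id, Pi.neg_apply]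
    field_simp
  rw [intervalIntegral.integral_eq_sub_of_hasDerivAt hderiv
    ((continuous_gaussianShape β).intervalIntegrable _ _)]
  simp

theorem integral_gaussianShape_le (β : ℝ) {s : ℝ} (hs : 0 ≤ s) :
    ∫ u in (0 : ℝ)..s, gaussianShape β u ≤ |β| / Real.pi := by
  have hexp_le : Real.exp (-s / 4) ≤ 1 := Real.exp_le_one_iff.2 (by linarith)
  have hexp_pos := Real.exp_pos (-s / 4)
  rw [integral_gaussianShape, div_mul_eq_mul_div]
  gcongr
  exact (mul_le_mul_of_nonneg_right (le_abs_self β) (sub_nonneg.2 hexp_le)).trans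
    (mul_le_of_le_one_right (abs_nonneg β) (by linarith))

theorem gaussian_eq_exp_neg_mul_norm_sq :
    gaussian = fun x => (4 * Real.pi)⁻¹ * Real.exp (-(1 / 4) * ‖x‖ ^ 2) := by
  ext x
  rw [gaussian, neg_div, neg_mul, div_eq_inv_mul, one_div]

theorem integrable_gaussian : Integrable gaussian := by
  rw [gaussian_eq_exp_neg_mul_norm_sq]
  exact (integrable_exp_neg_mul_norm_sq (by norm_num)).const_mul _

theorem integral_gaussian_eq_one : ∫ x, gaussian x = 1 := by
  rw [gaussian_eq_exp_neg_mul_norm_sq, integral_const_mul,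
    GaussianFourier.integral_rexp_neg_mul_sq_norm (by norm_num)]
  simp only [finrank_euclideanSpace_fin, Nat.cast_ofNat, div_self (two_ne_zero' ℝ), Real.rpow_one]
  field_simp

/-- The vortex profile of mass one in the radial strain of a Gaussian divergence of mass `β`. -/
noncomputable def vortexProfile (β : ℝ) (x : Plane) : ℝ :=
  (∫ y : Plane, driftShape (gaussianShape β) (‖y‖ ^ 2))⁻¹ * driftShape (gaussianShape β) (‖x‖ ^ 2)

theorem profile_ode_iff_radialFlux_eq_zero {β : ℝ} {F : ℝ → ℝ} {x : Plane} (hx : x ≠ 0)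
    (hF : DifferentiableAt ℝ F (‖x‖ ^ 2)) (hF_ne : F (‖x‖ ^ 2) ≠ 0) :
    radialDeriv (fun y => F (‖y‖ ^ 2)) x / F (‖x‖ ^ 2)
        = -‖x‖ / 2 + β / (2 * Real.pi * ‖x‖) * (1 - Real.exp (-(‖x‖ ^ 2) / 4)) ↔
      radialFlux (gaussianShape β) F (‖x‖ ^ 2) = 0 := by
  have : 0 < ‖x‖ := norm_pos_iff.2 hx
  have hradial : radialDeriv (fun y => F (‖y‖ ^ 2)) x = 2 * ‖x‖ * deriv F (‖x‖ ^ 2) := by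
    rw [radialDeriv, map_smul, fderiv_comp_norm_sq_self hF, smul_eq_mul]
    field_simp
  have hflux : radialFlux (gaussianShape β) F (‖x‖ ^ 2) = 2 * ‖x‖ *
      (2 * ‖x‖ * deriv F (‖x‖ ^ 2) - (-‖x‖ / 2
        + β / (2 * Real.pi * ‖x‖) * (1 - Real.exp (-(‖x‖ ^ 2) / 4))) * F (‖x‖ ^ 2)) := by
    rw [radialFlux, integral_gaussianShape]
    field_simp
    ring
  rw [hradial, div_eq_iff hF_ne, hflux, mul_eq_zero_iff_left (by positivity), sub_eq_zero]

theorem isVortexProfile_vortexProfile (β : ℝ) : IsVortexProfile β (vortexProfile β) := by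
  have hshape := contDiff_driftShape (contDiff_gaussianShape β)
  have hint := integrable_driftShape_norm_sq (continuous_gaussianShape β)
    fun _ => integral_gaussianShape_le β
  have hmass := integral_driftShape_norm_sq_pos (continuous_gaussianShape β)
    fun _ => integral_gaussianShape_le β
  have hsmooth : ContDiff ℝ 2 (vortexProfile β) :=
    contDiff_const.mul (hshape.comp (contDiff_norm_sq ℝ))
  have hne (x : Plane) : vortexProfile β x ≠ 0 :=
    (mul_pos (inv_pos.2 hmass) (driftShape_pos _ _)).ne'
  refine
    { continuous := hsmooth.continuous
      radial := fun x y hxy => by rw [vortexProfile, vortexProfile, hxy]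
      differentiableAt := fun x _ => hsmooth.differentiable two_ne_zero x
      ne_zero := fun x _ => hne x
      ode := fun x hx => ?_
      integrable := hint.const_mul _
      mass := ?_ }
  · exact (profile_ode_iff_radialFlux_eq_zero hx
      ((hshape.differentiable two_ne_zero).const_mul _ _) (hne x)).2
      (congrFun (radialFlux_const_mul_driftShape (continuous_gaussianShape β) _) _)
  · simp only [vortexProfile]
    rw [integral_const_mul, inv_mul_cancel₀ hmass.ne']

theorem IsVortexProfile.eq_vortexProfile {β : ℝ} {W : Plane → ℝ} (hW : IsVortexProfile β W) :
    W = vortexProfile β := by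
  have hdiff : ∀ s, 0 < s → DifferentiableAt ℝ (radialPart W) s := fun s hs =>
    (hasDerivAt_radialPart hs
      (hW.differentiableAt _ (sqrt_smul_rayDirection_ne_zero hs))).differentiableAt
  have hflux : ∀ s, 0 < s → radialFlux (gaussianShape β) (radialPart W) s = 0 := by
    intro s hs
    have hne := sqrt_smul_rayDirection_ne_zero hs
    have hs_sq := norm_sq_sqrt_smul_rayDirection hs.le
    have hiff := profile_ode_iff_radialFlux_eq_zero (β := β) (F := radialPart W) hne
      (hs_sq.symm ▸ hdiff s hs) (hs_sq.symm ▸ hW.ne_zero _ hne)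
    have hode := hW.ode _ hne
    rw [hW.radial.eq_radialPart] at hode
    exact hs_sq ▸ hiff.1 hode
  obtain ⟨c, hc⟩ := exists_eq_mul_driftShape (continuous_gaussianShape β)
    (continuous_radialPart hW.continuous) hdiff hflux
  have hW_eq : W = fun x => c * driftShape (gaussianShape β) (‖x‖ ^ 2) := by
    rw [hW.radial.eq_radialPart]
    ext x
    exact hc _ (sq_nonneg _)
  have hmass := hW.mass
  rw [hW_eq, integral_const_mul] at hmass
  ext x
  rw [congrFun hW_eq x, vortexProfile, eq_inv_of_mul_eq_one_left hmass]

theorem isSelfSimilarProfile_vortexProfile_gaussian (α β : ℝ) :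
    IsSelfSimilarProfile (fun x => α * vortexProfile β x) (fun x => β * gaussian x) := by
  have hβ_cont := continuous_gaussianShape β
  set c := α * (∫ y : Plane, driftShape (gaussianShape β) (‖y‖ ^ 2))⁻¹ with hc
  have hvortex : (fun x => α * vortexProfile β x)
      = fun x => c * driftShape (gaussianShape β) (‖x‖ ^ 2) := by
    ext x
    rw [vortexProfile, hc, mul_assoc]
  rw [hvortex, funext (mul_gaussian β)]
  refine isSelfSimilarProfile_comp_norm_sq (F := fun s => c * driftShape (gaussianShape β) s)
    (contDiff_const.mul (contDiff_driftShape (contDiff_gaussianShape β)))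
    (contDiff_gaussianShape β) (fun x => ?_) ?_
    (radialFlux_const_mul_driftShape hβ_cont c) ?_
  · exact convolutionExistsAt_kernelBS_iff.2
      (convolutionExists_driftShape_norm_sq hβ_cont (fun _ => integral_gaussianShape_le β) c x)
  · rw [gaussianShape_eq_mul_driftShape]
    exact convolutionExists_driftShape_norm_sq continuous_zero (M := 0) (by simp) _
  · rw [gaussianShape_eq_mul_driftShape]
    exact radialFlux_const_mul_driftShape continuous_zero _

theorem isRadial_gaussian : IsRadial gaussian := fun x y h => by rw [gaussian, gaussian, h]

theorem IsRadial.const_mul {f : Plane → ℝ} (hf : IsRadial f) (c : ℝ) :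
    IsRadial (fun x => c * f x) := fun x y h => congrArg (c * ·) (hf x y h)

theorem IsSelfSimilar.const_mul {f : ℝ → Plane → ℝ} (hf : IsSelfSimilar f) (c : ℝ) :
    IsSelfSimilar (fun t x => c * f t x) := fun l hl t ht x => by
  rw [mul_left_comm, hf l hl t ht x]

theorem isRadialSelfSimilarSolution_rescale (α β : ℝ) :
    IsRadialSelfSimilarSolution (fun t x => α * rescale (vortexProfile β) t x)
      (fun t x => β * rescale gaussian t x) where
  solution := by
    refine IsSelfSimilarProfile.isSolution ?_ ((isSelfSimilar_rescale _).const_mul α)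
      ((isSelfSimilar_rescale _).const_mul β)
    simpa only [rescale_one] using isSelfSimilarProfile_vortexProfile_gaussian α β
  radial_vorticity t _ := ((isVortexProfile_vortexProfile β).radial.rescale t).const_mul α
  radial_div t _ := (isRadial_gaussian.rescale t).const_mul β
  selfSimilar_vorticity := (isSelfSimilar_rescale _).const_mul α
  selfSimilar_div := (isSelfSimilar_rescale _).const_mul β

theorem IsSelfSimilarProfile.exists_eq_gaussian {W Q : Plane → ℝ} (h : IsSelfSimilarProfile W Q)
    (hQ : IsRadial Q) : ∃ β : ℝ, Q = fun x => β * gaussian x := by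
  obtain ⟨c, hc⟩ := exists_eq_mul_driftShape continuous_zero
    (continuous_radialPart h.contDiff_div.continuous)
    (fun s hs => (contDiffAt_radialPart h.contDiff_div hs).differentiableAt two_ne_zero)
    (fun s hs => h.radialFlux_div_eq_zero hQ hs)
  refine ⟨c * (4 * Real.pi), ?_⟩
  rw [hQ.eq_radialPart]
  ext x
  rw [hc _ (sq_nonneg _), mul_gaussian, gaussianShape_eq_mul_driftShape,
    mul_div_cancel_right₀ _ (by positivity)]

theorem IsSelfSimilarProfile.exists_eq_vortexProfile {W : Plane → ℝ} {β : ℝ}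
    (h : IsSelfSimilarProfile W fun x => β * gaussian x) (hW : IsRadial W) :
    ∃ α : ℝ, W = fun x => α * vortexProfile β x := by
  have hβ_cont := continuous_gaussianShape β
  have hradialPart : EqOn (radialPart fun x => β * gaussian x) (gaussianShape β) (Ici 0) :=
    fun s hs => (mul_gaussian β _).trans (by rw [norm_sq_sqrt_smul_rayDirection hs])
  have hflux : ∀ s, 0 < s → radialFlux (gaussianShape β) (radialPart W) s = 0 := by
    intro s hs
    have hdrift : ∫ u in (0 : ℝ)..s, gaussianShape β u
        = ∫ u in (0 : ℝ)..s, radialPart (fun x => β * gaussian x) u := by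
      refine intervalIntegral.integral_congr fun u hu => (hradialPart ?_).symm
      rw [uIcc_of_le hs.le] at hu
      exact hu.1
    rw [← h.radialFlux_vorticity_eq_zero hW (isRadial_gaussian.const_mul β) hs, radialFlux,
      radialFlux, hdrift]
  obtain ⟨c, hc⟩ := exists_eq_mul_driftShape hβ_cont
    (continuous_radialPart h.contDiff_vorticity.continuous)
    (fun s hs => (contDiffAt_radialPart h.contDiff_vorticity hs).differentiableAt two_ne_zero) hflux
  have hmass := integral_driftShape_norm_sq_pos hβ_cont fun _ => integral_gaussianShape_le β
  refine ⟨c * ∫ y : Plane, driftShape (gaussianShape β) (‖y‖ ^ 2), ?_⟩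
  rw [hW.eq_radialPart]
  ext x
  rw [hc _ (sq_nonneg _), vortexProfile, mul_assoc, mul_inv_cancel_left₀ hmass.ne']

theorem IsRadialSelfSimilarSolution.exists_eq_profile {ω d : ℝ → Plane → ℝ}
    (h : IsRadialSelfSimilarSolution ω d) :
    ∃ α β : ℝ, (ω 1 = fun x => α * vortexProfile β x) ∧ d 1 = fun x => β * gaussian x := by
  have hprofile := h.solution.isSelfSimilarProfile h.selfSimilar_vorticity h.selfSimilar_div
  obtain ⟨β, hβ⟩ := hprofile.exists_eq_gaussian (h.radial_div 1 one_pos)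
  obtain ⟨α, hα⟩ := (hβ ▸ hprofile).exists_eq_vortexProfile (h.radial_vorticity 1 one_pos)
  exact ⟨α, β, hα, hβ⟩

theorem IsSelfSimilar.eq_const_mul_rescale {f : ℝ → Plane → ℝ} (hf : IsSelfSimilar f) {c : ℝ}
    {P : Plane → ℝ} (h : f 1 = fun x => c * P x) {t : ℝ} (ht : 0 < t) (x : Plane) :
    f t x = c * rescale P t x := by
  rw [hf.eq_rescale ht, h, rescale, rescale, mul_left_comm]

theorem IsSelfSimilar.integrable {f : ℝ → Plane → ℝ} (hf : IsSelfSimilar f)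
    (h : Integrable (f 1)) {t : ℝ} (ht : 0 < t) : Integrable (f t) :=
  hf.eq_rescale ht ▸ integrable_rescale h ht

theorem IsSelfSimilar.integral_eq {f : ℝ → Plane → ℝ} (hf : IsSelfSimilar f) {t : ℝ}
    (ht : 0 < t) : ∫ x, f t x = ∫ x, f 1 x := by
  rw [hf.eq_rescale ht, integral_rescale _ ht]

end ExtendedNS

open ExtendedNS in
theorem mainTheorem4 :
    (∀ β : ℝ, ∃! W : ExtendedNS.Plane → ℝ, ExtendedNS.IsVortexProfile β W) ∧
    (∀ (α β : ℝ) (W : ExtendedNS.Plane → ℝ), ExtendedNS.IsVortexProfile β W →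
      ExtendedNS.IsRadialSelfSimilarSolution
        (fun t x => α * ExtendedNS.rescale W t x)
        (fun t x => β * ExtendedNS.rescale ExtendedNS.gaussian t x)) ∧
    (∀ ω d : ℝ → ExtendedNS.Plane → ℝ, ExtendedNS.IsRadialSelfSimilarSolution ω d →
      ∃ (α β : ℝ) (W : ExtendedNS.Plane → ℝ), ExtendedNS.IsVortexProfile β W ∧
        ∀ t : ℝ, 0 < t →
          (∀ x, ω t x = α * ExtendedNS.rescale W t x) ∧
          (∀ x, d t x = β * ExtendedNS.rescale ExtendedNS.gaussian t x) ∧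
          MeasureTheory.Integrable (ω t) ∧ ∫ x, ω t x = α ∧
          MeasureTheory.Integrable (d t) ∧ ∫ x, d t x = β) := by
  refine ⟨fun β => ⟨vortexProfile β, isVortexProfile_vortexProfile β, fun W hW =>
    hW.eq_vortexProfile⟩, fun α β W hW => ?_, fun ω d h => ?_⟩
  · exact hW.eq_vortexProfile ▸ isRadialSelfSimilarSolution_rescale α β
  · obtain ⟨α, β, hω_one, hd_one⟩ := h.exists_eq_profile
    have hω := h.selfSimilar_vorticity
    have hd := h.selfSimilar_div
    have hprofile := isVortexProfile_vortexProfile β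
    have hω_int : Integrable (ω 1) := hω_one ▸ hprofile.integrable.const_mul α
    have hd_int : Integrable (d 1) := hd_one ▸ integrable_gaussian.const_mul β
    refine ⟨α, β, vortexProfile β, hprofile, fun t ht =>
      ⟨hω.eq_const_mul_rescale hω_one ht, hd.eq_const_mul_rescale hd_one ht,
        hω.integrable hω_int ht, ?_, hd.integrable hd_int ht, ?_⟩⟩
    · rw [hω.integral_eq ht, hω_one, integral_const_mul, hprofile.mass, mul_one]
    · rw [hd.integral_eq ht, hd_one, integral_const_mul, integral_gaussian_eq_one, mul_one]
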